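/- Let $d\in\mathbb{N}$ and let $(p_t)_{t\ge 0}$ be a weakly continuous convolution semigroup of probability measures on $\mathbb{R}^d$ (that is, $p_0=\delta_0$, $p_{s+t}=p_s*p_t$ for $s,t\ge0$, and $p_t\to\delta_0$ weakly as $t\to0^+$; equivalently, $p_t$ is the distribution at time $t$ of a Lévy process in $\mathbb{R}^d$ started at $0$). Let $P_tf(x)=\int_{\mathbb{R}^d} f(z+x)\,p_t(dz)$ be the corresponding semigroup on the space $(C_0(\mathbb{R}^d),\|\cdot\|_\infty)$ of real continuous functions vanishing at infinity, and let $L$ be its infinitesimal generator: $Lf=\lim_{t\to0^+}(P_tf-f)/t$ in norm, with domain $D(L)$ consisting of all $f\in C_0(\mathbb{R}^d)$ for which this limit exists. Let $A$ be a closed linear operator with domain $D(A)\subset C_0(\mathbb{R}^d)$ and values in $C_0(\mathbb{R}^d)$, having $C_c^\infty(\mathbb{R}^d)$ as a core (that is, $C_c^\infty(\mathbb{R}^d)\subset D(A)$ and $A$ is the closure of its restriction to $C_c^\infty(\mathbb{R}^d)$). Suppose that for all $s\in\mathbb{R}$, $x\in\mathbb{R}^d$ and $\phi\in C_c^\infty(\mathbb{R}\times\mathbb{R}^d)$,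 $$\int_s^\infty\int_{\mathbb{R}^d}\Big[\partial_u\phi(u,x+z)+A\phi(u,x+z)\Big]\,p_{u-s}(dz)\,du=-\phi(s,x),$$ where $A\phi(u,x+z)=\big(A\,\phi(u,\cdot)\big)(x+z)$. Then $A=L$, that is, $D(A)=D(L)$ and $Af=Lf$ for all $f\in D(A)$. -/

import Mathlib

open MeasureTheory Filter Topology
open scoped NNReal ContDiff ZeroAtInfty

noncomputable section

/-! ### The infinitesimal generator of a family of operators -/

section Generator

variable {Y : Type*} [NormedAddCommGroup Y] [NormedSpace ℝ Y]

/-- `g` is the norm limit of `(T_t f - f) / t` as `t → 0+`. -/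
def IsGeneratorValue (T : ℝ≥0 → Y →ₗ[ℝ] Y) (f g : Y) : Prop :=
  Tendsto (fun t : ℝ≥0 => (t : ℝ)⁻¹ • (T t f - f)) (𝓝[>] 0) (𝓝 g)

theorem IsGeneratorValue.unique {T : ℝ≥0 → Y →ₗ[ℝ] Y} {f g g' : Y}
    (h : IsGeneratorValue T f g) (h' : IsGeneratorValue T f g') : g = g' :=
  tendsto_nhds_unique h h'

theorem IsGeneratorValue.add {T : ℝ≥0 → Y →ₗ[ℝ] Y} {f₁ f₂ g₁ g₂ : Y}
    (h₁ : IsGeneratorValue T f₁ g₁) (h₂ : IsGeneratorValue T f₂ g₂) :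
    IsGeneratorValue T (f₁ + f₂) (g₁ + g₂) := by
  refine (Tendsto.add h₁ h₂).congr fun t => ?_
  rw [map_add, ← smul_add]
  congr 1
  abel

theorem IsGeneratorValue.smul {T : ℝ≥0 → Y →ₗ[ℝ] Y} {f g : Y} (c : ℝ)
    (h : IsGeneratorValue T f g) : IsGeneratorValue T (c • f) (c • g) := by
  refine (Tendsto.const_smul h c).congr fun t => ?_
  rw [map_smul, ← smul_sub, smul_comm]

/-- The infinitesimal generator of the family `T`: its domain is the set of all `f` for which
`(T_t f - f) / t` converges in norm as `t → 0+`, and its value at `f` is the limit. -/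
def infinitesimalGenerator (T : ℝ≥0 → Y →ₗ[ℝ] Y) : Y →ₗ.[ℝ] Y where
  domain :=
    { carrier := {f | ∃ g, IsGeneratorValue T f g}
      zero_mem' := ⟨0, by simp [IsGeneratorValue]⟩
      add_mem' := fun ⟨g₁, h₁⟩ ⟨g₂, h₂⟩ => ⟨g₁ + g₂, h₁.add h₂⟩
      smul_mem' := fun c _ ⟨g, h⟩ => ⟨c • g, h.smul c⟩ }
  toFun :=
    { toFun := fun f => Classical.choose f.2
      map_add' := fun f₁ f₂ => (Classical.choose_spec (f₁ + f₂).2).unique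
        ((Classical.choose_spec f₁.2).add (Classical.choose_spec f₂.2))
      map_smul' := fun c f => (Classical.choose_spec (c • f).2).unique
        ((Classical.choose_spec f.2).smul c) }

end Generator

/-! ### Lévy semigroups -/

/-- A weakly continuous convolution semigroup `(p_t)_{t ≥ 0}` of probability measures on `ℝ^d`,
that is, the one-dimensional distributions of a Lévy process in `ℝ^d` started at `0`. (The topology
on `ProbabilityMeasure` is that of weak convergence.) -/
structure ConvolutionSemigroup (d : ℕ) where
  law : ℝ≥0 → ProbabilityMeasure (EuclideanSpace ℝ (Fin d))
  law_zero : (law 0 : Measure (EuclideanSpace ℝ (Fin d))) = Measure.dirac 0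
  law_add : ∀ s t : ℝ≥0, (law (s + t) : Measure (EuclideanSpace ℝ (Fin d))) =
    Measure.conv (law s : Measure (EuclideanSpace ℝ (Fin d))) (law t)
  tendsto_law : Tendsto law (𝓝 0) (𝓝 (law 0))

theorem integrable_translate {d : ℕ} (μ : ProbabilityMeasure (EuclideanSpace ℝ (Fin d)))
    (f : C₀(EuclideanSpace ℝ (Fin d), ℝ)) (x : EuclideanSpace ℝ (Fin d)) :
    Integrable (fun z => f (z + x)) (μ : Measure (EuclideanSpace ℝ (Fin d))) := by
  refine Integrable.of_bound (C := ‖f.toBCF‖) ?_ ?_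
  · exact (f.continuous.comp (continuous_id.add continuous_const)).aestronglyMeasurable
  · exact Eventually.of_forall fun z => f.toBCF.norm_coe_le_norm (z + x)

/-- The operator `f ↦ (x ↦ ∫ f(z + x) μ(dz))` on `C₀(ℝ^d)`, for a probability measure `μ`. -/
def translationAverage {d : ℕ} (μ : ProbabilityMeasure (EuclideanSpace ℝ (Fin d))) :
    C₀(EuclideanSpace ℝ (Fin d), ℝ) →ₗ[ℝ] C₀(EuclideanSpace ℝ (Fin d), ℝ) where
  toFun f :=
    { toFun := fun x => ∫ z, f (z + x) ∂(μ : Measure (EuclideanSpace ℝ (Fin d)))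
      continuous_toFun := by
        refine continuous_of_dominated (bound := fun _ => ‖f.toBCF‖) ?_ ?_ ?_ ?_
        · exact fun x => (integrable_translate μ f x).aestronglyMeasurable
        · exact fun x => Eventually.of_forall fun z => f.toBCF.norm_coe_le_norm (z + x)
        · exact integrable_const _
        · exact Eventually.of_forall fun z =>
            f.continuous.comp (continuous_const.add continuous_id)
      zero_at_infty' := by
        have hcg : (cocompact (EuclideanSpace ℝ (Fin d))).IsCountablyGenerated := by
          rw [← Metric.cobounded_eq_cocompact, ← comap_norm_atTop]
          infer_instance
        have h := tendsto_integral_filter_of_dominated_convergence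
          (μ := (μ : Measure (EuclideanSpace ℝ (Fin d))))
          (l := cocompact (EuclideanSpace ℝ (Fin d)))
          (F := fun x z => f (z + x)) (f := fun _ => (0 : ℝ)) (fun _ => ‖f.toBCF‖)
          (Eventually.of_forall fun x => (integrable_translate μ f x).aestronglyMeasurable)
          (Eventually.of_forall fun x =>
            Eventually.of_forall fun z => f.toBCF.norm_coe_le_norm (z + x))
          (integrable_const _)
          (Eventually.of_forall fun z =>
            f.zero_at_infty'.comp (Homeomorph.addLeft z).isClosedEmbedding.tendsto_cocompact)
        simpa using h }
  map_add' f g := by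
    ext x
    exact integral_add (integrable_translate μ f x) (integrable_translate μ g x)
  map_smul' c f := by
    ext x
    exact integral_const_mul c _

/-- The Lévy semigroup `P_t f(x) = ∫ f(z + x) p_t(dz)` on `C₀(ℝ^d)`. -/
def levySemigroup {d : ℕ} (p : ConvolutionSemigroup d) (t : ℝ≥0) :
    C₀(EuclideanSpace ℝ (Fin d), ℝ) →ₗ[ℝ] C₀(EuclideanSpace ℝ (Fin d), ℝ) :=
  translationAverage (p.law t)

/-- The Lévy generator: the infinitesimal generator of `(P_t)` on `(C₀(ℝ^d), ‖·‖_∞)`. -/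
def levyGenerator {d : ℕ} (p : ConvolutionSemigroup d) :
    C₀(EuclideanSpace ℝ (Fin d), ℝ) →ₗ.[ℝ] C₀(EuclideanSpace ℝ (Fin d), ℝ) :=
  infinitesimalGenerator (levySemigroup p)

/-! ### Test functions -/

/-- `C_c^∞(ℝ^d)` as a linear subspace of `C₀(ℝ^d)`. -/
def smoothCompact (d : ℕ) : Submodule ℝ C₀(EuclideanSpace ℝ (Fin d), ℝ) where
  carrier := {f | ContDiff ℝ ∞ (f : EuclideanSpace ℝ (Fin d) → ℝ) ∧
    HasCompactSupport (f : EuclideanSpace ℝ (Fin d) → ℝ)}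
  zero_mem' := ⟨contDiff_const, HasCompactSupport.zero⟩
  add_mem' := fun hf hg => ⟨hf.1.add hg.1, hf.2.add hg.2⟩
  smul_mem' := fun c _ hf => ⟨contDiff_const.mul hf.1, hf.2.mul_left (f := fun _ => c)⟩

/-- `C_c^∞(ℝ × ℝ^d)`, the smooth compactly supported functions on space-time. -/
structure SpaceTimeTest (d : ℕ) where
  toFun : ℝ × EuclideanSpace ℝ (Fin d) → ℝ
  smooth : ContDiff ℝ ∞ toFun
  compact_support : HasCompactSupport toFun

theorem SpaceTimeTest.slice_contDiff {d : ℕ} (φ : SpaceTimeTest d) (u : ℝ) :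
    ContDiff ℝ ∞ fun y => φ.toFun (u, y) :=
  φ.smooth.comp (contDiff_const.prodMk contDiff_id)

theorem SpaceTimeTest.slice_hasCompactSupport {d : ℕ} (φ : SpaceTimeTest d) (u : ℝ) :
    HasCompactSupport fun y => φ.toFun (u, y) :=
  φ.compact_support.comp_isClosedEmbedding
    (Topology.IsClosedEmbedding.of_continuous_injective_isClosedMap (by fun_prop)
      (Prod.mk_right_injective u) (isClosedMap_prodMk_left u))

/-- The function `φ(u, ·)` on `ℝ^d`, as an element of `C₀(ℝ^d)`. -/
def SpaceTimeTest.slice {d : ℕ} (φ : SpaceTimeTest d) (u : ℝ) :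
    C₀(EuclideanSpace ℝ (Fin d), ℝ) where
  toFun := fun y => φ.toFun (u, y)
  continuous_toFun := (φ.slice_contDiff u).continuous
  zero_at_infty' := (φ.slice_hasCompactSupport u).is_zero_at_infty

theorem SpaceTimeTest.slice_mem {d : ℕ} (φ : SpaceTimeTest d) (u : ℝ) :
    φ.slice u ∈ smoothCompact d :=
  ⟨φ.slice_contDiff u, φ.slice_hasCompactSupport u⟩

end

/-!
Write `P_t` for the semigroup, `L` for its generator and `C` for `C_c^∞(ℝ^d)`. Throughout, `P_t f` is
regarded as the Bochner integral `∫ f(z + ·) p_t(dz)` of translates of `f` in `C₀`, which gives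
contractivity, the semigroup property and strong continuity.

**`A` is a restriction of `L`.** For `f ∈ C`, testing the hypothesis on products `γ(u) f(x)` says that
`u ↦ P_u f(x)` has distributional derivative `P_u A f(x)` on `(0, ∞)`, with the correct initial
value. Hence `P_t f - f = ∫₀ᵗ P_u A f du` (`levySemigroup_sub_eq_integral_of_mem_smoothCompact`). Both
sides are continuous in the pair `(f, A f)`, so the equation extends to `D(A)` by the core
property, and dividing by `t` gives `A f = L f` (`isGeneratorValue_of_mem_graph`).

**`L` is not larger than `A`.** The generator is dissipative, `‖f‖ ≤ ‖f - L f‖`, and so the closed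
operator `A` equals `L` as soon as `(1 - A) C` is dense (`eq_infinitesimalGenerator_of_dense_range`).
If a functional `ℓ` annihilates `(1 - A) C`, put `h(x) = ℓ(f(x + ·))` for `f ∈ C`. Translations
preserve `C` and commute with `P_t`, so `h` is a bounded continuous solution of `h = L h`.
Dissipativity, used this time for the seminorm `f ↦ sup_x |ℓ(f(x + ·))|`, which does not increase
along `P_t` either, yields `h = 0` (`dense_range_sub_of_isGeneratorValue`). Thus `ℓ` vanishes on `C`,
which is dense in `C₀`, and `ℓ = 0`.
-/

/-! ### Evaluation, translation and smooth approximation in `C₀` -/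

section ZeroAtInfty

theorem ZeroAtInftyContinuousMap.abs_apply_le_norm {E : Type*} [TopologicalSpace E]
    (f : C₀(E, ℝ)) (x : E) : |f x| ≤ ‖f‖ :=
  f.toBCF.norm_coe_le_norm x

theorem ZeroAtInftyContinuousMap.norm_le_of_forall_abs_le {E : Type*} [TopologicalSpace E]
    {f : C₀(E, ℝ)} {C : ℝ} (hC : 0 ≤ C) (h : ∀ x, |f x| ≤ C) : ‖f‖ ≤ C :=
  (BoundedContinuousFunction.norm_le (f := f.toBCF) hC).2 h

/-- Evaluation at `x`, as a continuous linear functional on `C₀(E)`. -/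
noncomputable def evalC0 {E : Type*} [TopologicalSpace E] (x : E) : C₀(E, ℝ) →L[ℝ] ℝ :=
  LinearMap.mkContinuous
    { toFun := fun f => f x
      map_add' := fun _ _ => rfl
      map_smul' := fun _ _ => rfl } 1
    (fun f => by simpa using f.abs_apply_le_norm x)

variable {E : Type*} [NormedAddCommGroup E]

/-- Translation `f ↦ f(z + ·)`, as a continuous linear operator on `C₀(E)`. -/
noncomputable def translateC0 (z : E) : C₀(E, ℝ) →L[ℝ] C₀(E, ℝ) :=
  LinearMap.mkContinuous
    (ZeroAtInftyContinuousMap.compLinearMap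
      ⟨⟨fun x => z + x, by fun_prop⟩,
        (Homeomorph.addLeft z).isClosedEmbedding.tendsto_cocompact⟩) 1
    (fun f => by
      rw [one_mul]
      exact ZeroAtInftyContinuousMap.norm_le_of_forall_abs_le (norm_nonneg _)
        fun x => f.abs_apply_le_norm (z + x))

@[simp]
theorem translateC0_apply (z : E) (f : C₀(E, ℝ)) (x : E) : translateC0 z f x = f (z + x) := rfl

theorem translateC0_translateC0 (z w : E) (f : C₀(E, ℝ)) :
    translateC0 z (translateC0 w f) = translateC0 (w + z) f := by
  ext x
  simp [add_assoc]

@[simp]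
theorem translateC0_zero (f : C₀(E, ℝ)) : translateC0 0 f = f := by
  ext x
  simp

theorem norm_translateC0_le (z : E) (f : C₀(E, ℝ)) : ‖translateC0 z f‖ ≤ ‖f‖ :=
  ZeroAtInftyContinuousMap.norm_le_of_forall_abs_le (norm_nonneg _)
    fun x => f.abs_apply_le_norm (z + x)

theorem continuous_translateC0 (f : C₀(E, ℝ)) : Continuous fun z : E => translateC0 z f := by
  rw [Metric.continuous_iff]
  intro z ε hε
  obtain ⟨δ, hδ, h⟩ := Metric.uniformContinuous_iff.1
    (ZeroAtInftyContinuousMap.uniformContinuous f) (ε / 2) (half_pos hε)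
  refine ⟨δ, hδ, fun w hw => ?_⟩
  rw [dist_eq_norm]
  refine (ZeroAtInftyContinuousMap.norm_le_of_forall_abs_le (half_pos hε).le
    fun x => ?_).trans_lt (half_lt_self hε)
  have := h (a := w + x) (b := z + x) (by simpa using hw)
  rw [Real.dist_eq] at this
  simpa using this.le

/-- Soft thresholding `f ↦ f - max (-ε) (min f ε)` makes the support compact at the cost of a
uniform error `ε`, and a compactly supported function has smooth uniform approximations with
smaller support. -/
theorem dense_smoothCompact (d : ℕ) :
    Dense (smoothCompact d : Set C₀(EuclideanSpace ℝ (Fin d), ℝ)) := by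
  rw [Metric.dense_iff]
  intro f r hr
  obtain ⟨ε, hε, hεr⟩ : ∃ ε : ℝ, 0 < ε ∧ 2 * ε < r := ⟨r / 4, by positivity, by linarith⟩
  let k : EuclideanSpace ℝ (Fin d) → ℝ := fun x => f x - max (-ε) (min (f x) ε)
  have hk : Continuous k :=
    f.continuous.sub (continuous_const.max (f.continuous.min continuous_const))
  have hkf : ∀ x, |k x - f x| ≤ ε := fun x => by
    simp only [k]
    rw [sub_sub_cancel_left, abs_neg, abs_le]
    exact ⟨le_max_left _ _, max_le (by linarith) (min_le_right _ _)⟩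
  have hkc : HasCompactSupport k := by
    have h : ∀ᶠ x in cocompact _, |f x| < ε := by
      have := (f.zero_at_infty'.abs).eventually_lt_const (u := ε) (by simpa using hε)
      exact this
    obtain ⟨K, hK, hKs⟩ := mem_cocompact.1 h
    refine HasCompactSupport.intro hK fun x hx => ?_
    have : |f x| < ε := hKs hx
    rw [abs_lt] at this
    simp only [k]
    rw [min_eq_left this.2.le, max_eq_right this.1.le, sub_self]
  obtain ⟨g, hg, hgk, hgs⟩ := hk.exists_contDiff_approx ⊤ (ε := fun _ => ε) continuous_const
    fun _ => hε
  have hgc : HasCompactSupport g := hkc.mono hgs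
  refine ⟨⟨⟨g, hg.continuous⟩, hgc.is_zero_at_infty⟩, ?_, hg, hgc⟩
  rw [Metric.mem_ball, dist_eq_norm]
  refine (ZeroAtInftyContinuousMap.norm_le_of_forall_abs_le (by positivity : 0 ≤ 2 * ε)
    fun x => ?_).trans_lt hεr
  have h1 := (hgk x).le
  rw [Real.dist_eq] at h1
  have := abs_sub_le (g x) (k x) (f x)
  change |g x - f x| ≤ 2 * ε
  linarith [hkf x]

theorem translateC0_mem_smoothCompact {d : ℕ} {f : C₀(EuclideanSpace ℝ (Fin d), ℝ)}
    (hf : f ∈ smoothCompact d) (z : EuclideanSpace ℝ (Fin d)) :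
    translateC0 z f ∈ smoothCompact d :=
  ⟨hf.1.comp (contDiff_const.add contDiff_id), hf.2.comp_homeomorph (Homeomorph.addLeft z)⟩

end ZeroAtInfty

/-! ### The Lévy semigroup -/

section LevySemigroup

variable {d : ℕ}

theorem integrable_translateC0 (μ : ProbabilityMeasure (EuclideanSpace ℝ (Fin d)))
    (f : C₀(EuclideanSpace ℝ (Fin d), ℝ)) :
    Integrable (fun z => translateC0 z f) (μ : Measure (EuclideanSpace ℝ (Fin d))) :=
  Integrable.of_bound (C := ‖f‖) (continuous_translateC0 f).aestronglyMeasurable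
    (Eventually.of_forall fun z => norm_translateC0_le z f)

/-- The translation average is a Bochner integral of translates, which reduces statements on the
semigroup to statements on translations. -/
theorem translationAverage_eq_integral (μ : ProbabilityMeasure (EuclideanSpace ℝ (Fin d)))
    (f : C₀(EuclideanSpace ℝ (Fin d), ℝ)) :
    translationAverage μ f = ∫ z, translateC0 z f ∂(μ : Measure (EuclideanSpace ℝ (Fin d))) := by
  ext x
  exact (evalC0 x).integral_comp_comm (integrable_translateC0 μ f)

/-- A bound on the images of all translates of `f` is inherited by the image of the average. -/
theorem norm_map_translationAverage_le {Z : Type*} [NormedAddCommGroup Z] [NormedSpace ℝ Z]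
    [CompleteSpace Z] (T : C₀(EuclideanSpace ℝ (Fin d), ℝ) →L[ℝ] Z)
    (μ : ProbabilityMeasure (EuclideanSpace ℝ (Fin d)))
    {f : C₀(EuclideanSpace ℝ (Fin d), ℝ)} {C : ℝ} (h : ∀ z, ‖T (translateC0 z f)‖ ≤ C) :
    ‖T (translationAverage μ f)‖ ≤ C := by
  rw [translationAverage_eq_integral, ← T.integral_comp_comm (integrable_translateC0 μ f)]
  simpa using norm_integral_le_of_norm_le_const
    (μ := (μ : Measure (EuclideanSpace ℝ (Fin d)))) (Eventually.of_forall h)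

theorem norm_levySemigroup_le (p : ConvolutionSemigroup d) (t : ℝ≥0)
    (f : C₀(EuclideanSpace ℝ (Fin d), ℝ)) : ‖levySemigroup p t f‖ ≤ ‖f‖ :=
  norm_map_translationAverage_le (ContinuousLinearMap.id ℝ _) (p.law t)
    fun z => norm_translateC0_le z f

theorem levySemigroup_translateC0 (p : ConvolutionSemigroup d) (t : ℝ≥0)
    (z : EuclideanSpace ℝ (Fin d)) (f : C₀(EuclideanSpace ℝ (Fin d), ℝ)) :
    levySemigroup p t (translateC0 z f) = translateC0 z (levySemigroup p t f) := by
  ext x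
  change ∫ w, f (z + (w + x)) ∂_ = ∫ w, f (w + (z + x)) ∂_
  simp only [add_left_comm]

theorem levySemigroup_zero (p : ConvolutionSemigroup d) (f : C₀(EuclideanSpace ℝ (Fin d), ℝ)) :
    levySemigroup p 0 f = f := by
  rw [levySemigroup, translationAverage_eq_integral, p.law_zero, integral_dirac, translateC0_zero]

theorem levySemigroup_add (p : ConvolutionSemigroup d) (s t : ℝ≥0)
    (f : C₀(EuclideanSpace ℝ (Fin d), ℝ)) :
    levySemigroup p (s + t) f = levySemigroup p s (levySemigroup p t f) := by
  have h := integrable_translateC0 (p.law (s + t)) f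
  rw [p.law_add] at h
  simp only [levySemigroup, translationAverage_eq_integral]
  rw [p.law_add, integral_conv h]
  refine integral_congr_ae (Eventually.of_forall fun z => ?_)
  simp only
  rw [← (translateC0 z).integral_comp_comm (integrable_translateC0 (p.law t) f)]
  simp only [translateC0_translateC0, add_comm]

/-- Since `‖P_t f - f‖ ≤ ∫ ‖f(z + ·) - f‖ p_t(dz)` and the integrand is a bounded continuous
function of `z` vanishing at `0`, this is the weak convergence `p_t → δ_0`. -/
theorem tendsto_levySemigroup_zero (p : ConvolutionSemigroup d)
    (f : C₀(EuclideanSpace ℝ (Fin d), ℝ)) :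
    Tendsto (fun t => ‖levySemigroup p t f - f‖) (𝓝 0) (𝓝 0) := by
  let m : BoundedContinuousFunction (EuclideanSpace ℝ (Fin d)) ℝ :=
    BoundedContinuousFunction.ofNormedAddCommGroup (fun z => ‖translateC0 z f - f‖)
      ((continuous_translateC0 f).sub continuous_const).norm (2 * ‖f‖) fun z => by
        rw [norm_norm]
        linarith [norm_sub_le (translateC0 z f) f, norm_translateC0_le z f]
  have h := ProbabilityMeasure.tendsto_iff_forall_integral_tendsto.1 p.tendsto_law m
  have h0 : ∫ z, m z ∂(p.law 0 : Measure (EuclideanSpace ℝ (Fin d))) = 0 := by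
    rw [p.law_zero, integral_dirac]
    simp [m]
  rw [h0] at h
  refine squeeze_zero (fun _ => norm_nonneg _) (fun t => ?_) h
  have : levySemigroup p t f - f =
      ∫ z, (translateC0 z f - f) ∂(p.law t : Measure (EuclideanSpace ℝ (Fin d))) := by
    rw [integral_sub (integrable_translateC0 (p.law t) f) (integrable_const _),
      levySemigroup, translationAverage_eq_integral]
    simp
  rw [this]
  exact norm_integral_le_integral_norm _

theorem norm_levySemigroup_add_sub_le (p : ConvolutionSemigroup d) (s t : ℝ≥0)
    (f : C₀(EuclideanSpace ℝ (Fin d), ℝ)) :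
    ‖levySemigroup p (s + t) f - levySemigroup p s f‖ ≤ ‖levySemigroup p t f - f‖ := by
  rw [levySemigroup_add, ← map_sub]
  exact norm_levySemigroup_le p s _

theorem continuous_levySemigroup_apply (p : ConvolutionSemigroup d)
    (f : C₀(EuclideanSpace ℝ (Fin d), ℝ)) : Continuous fun t => levySemigroup p t f := by
  rw [continuous_iff_continuousAt]
  intro s
  rw [ContinuousAt, tendsto_iff_norm_sub_tendsto_zero]
  have hd : Tendsto (fun t : ℝ≥0 => nndist t s) (𝓝 s) (𝓝 0) := by
    have : Continuous fun t : ℝ≥0 => nndist t s := by fun_prop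
    simpa using this.tendsto s
  refine squeeze_zero (fun _ => norm_nonneg _) (fun t => ?_)
    ((tendsto_levySemigroup_zero p f).comp hd)
  simp only [Function.comp]
  rcases le_total s t with h | h
  · obtain ⟨r, rfl⟩ := exists_add_of_le h
    have : nndist (s + r) s = r := by ext; simp [NNReal.dist_eq]
    rw [this]
    exact norm_levySemigroup_add_sub_le p s r f
  · obtain ⟨r, rfl⟩ := exists_add_of_le h
    have : nndist t (t + r) = r := by ext; simp [NNReal.dist_eq]
    rw [this, norm_sub_rev]
    exact norm_levySemigroup_add_sub_le p t r f

/-- Joint continuity of `(f, u) ↦ P_u f`; negative times are sent to `0`. -/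
theorem continuous_levySemigroup_toNNReal (p : ConvolutionSemigroup d) :
    Continuous fun q : C₀(EuclideanSpace ℝ (Fin d), ℝ) × ℝ =>
      levySemigroup p q.2.toNNReal q.1 := by
  refine continuous_prod_of_continuous_lipschitzWith _ 1
    (fun f => (continuous_levySemigroup_apply p f).comp continuous_real_toNNReal) fun u => ?_
  refine LipschitzWith.of_dist_le_mul fun f g => ?_
  simp only [NNReal.coe_one, one_mul, dist_eq_norm, ← map_sub]
  exact norm_levySemigroup_le p _ _

/-- The integrated form `P_t f - f = ∫₀ᵗ P_u g du` of `Lf = g` implies `Lf = g`. -/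
theorem isGeneratorValue_of_forall_integral_eq (p : ConvolutionSemigroup d)
    {f g : C₀(EuclideanSpace ℝ (Fin d), ℝ)}
    (h : ∀ t : ℝ≥0, levySemigroup p t f - f =
      ∫ u in (0 : ℝ)..t, levySemigroup p u.toNNReal g) :
    IsGeneratorValue (levySemigroup p) f g := by
  have hc : Continuous fun u : ℝ => levySemigroup p u.toNNReal g :=
    (continuous_levySemigroup_toNNReal p).comp (continuous_const.prodMk continuous_id)
  have hderiv := (hc.integral_hasStrictDerivAt 0 0).hasDerivAt.tendsto_slope_zero_right
  have hcoe : Tendsto (fun t : ℝ≥0 => (t : ℝ)) (𝓝[>] 0) (𝓝[>] 0) := by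
    refine tendsto_nhdsWithin_iff.2 ⟨?_, ?_⟩
    · exact (NNReal.continuous_coe.tendsto' 0 0 rfl).mono_left nhdsWithin_le_nhds
    · filter_upwards [self_mem_nhdsWithin] with t ht
      exact NNReal.coe_pos.2 ht
  have h' := hderiv.comp hcoe
  simp only [Real.toNNReal_zero, levySemigroup_zero] at h'
  refine h'.congr fun t => ?_
  simp [h t]

/-- A form of dissipativity of the generator `L`, in terms of any seminorm `f ↦ ‖T f‖`
that does not increase along the semigroup. -/
theorem IsGeneratorValue.norm_map_le {Y Z : Type*} [NormedAddCommGroup Y] [NormedSpace ℝ Y]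
    [NormedAddCommGroup Z] [NormedSpace ℝ Z] {P : ℝ≥0 → Y →ₗ[ℝ] Y} {f g : Y}
    (h : IsGeneratorValue P f g) (T : Y →L[ℝ] Z) (hT : ∀ t, ‖T (P t f)‖ ≤ ‖T f‖) :
    ‖T f‖ ≤ ‖T (f - g)‖ := by
  have hlim : Tendsto (fun t : ℝ≥0 => ‖T (f - (t : ℝ)⁻¹ • (P t f - f))‖) (𝓝[>] 0)
      (𝓝 ‖T (f - g)‖) :=
    ((T.continuous.tendsto _).comp (tendsto_const_nhds.sub h)).norm
  refine ge_of_tendsto hlim ?_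
  filter_upwards [self_mem_nhdsWithin] with t ht
  have ht' : (0 : ℝ) < (t : ℝ)⁻¹ := inv_pos.2 (NNReal.coe_pos.2 ht)
  have heq : T (f - (t : ℝ)⁻¹ • (P t f - f)) =
      (1 + (t : ℝ)⁻¹) • T f - (t : ℝ)⁻¹ • T (P t f) := by
    simp only [map_sub, map_smul, smul_sub, add_smul, one_smul]
    abel
  rw [heq]
  refine le_trans ?_ (norm_sub_norm_le _ _)
  rw [norm_smul, norm_smul, Real.norm_of_nonneg (by positivity), Real.norm_of_nonneg ht'.le]
  nlinarith [mul_le_mul_of_nonneg_left (hT t) ht'.le]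

theorem IsGeneratorValue.translateC0 {p : ConvolutionSemigroup d}
    {f g : C₀(EuclideanSpace ℝ (Fin d), ℝ)} (h : IsGeneratorValue (levySemigroup p) f g)
    (z : EuclideanSpace ℝ (Fin d)) :
    IsGeneratorValue (levySemigroup p) (translateC0 z f) (translateC0 z g) := by
  refine (((_root_.translateC0 z).continuous.tendsto _).comp h).congr fun t => ?_
  simp [levySemigroup_translateC0]

end LevySemigroup

/-! ### A weak first-order equation on the half-line -/

section Weak

/-- A test function on `(0, ∞)` is the derivative there of a test function on `ℝ`: extend it to an
odd function, which has integral zero, so that its primitive has compact support. -/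
theorem exists_contDiff_deriv_eq {ψ : ℝ → ℝ} (hψ : ContDiff ℝ ∞ ψ) (hc : HasCompactSupport ψ)
    (hs : tsupport ψ ⊆ Set.Ioi 0) :
    ∃ γ : ℝ → ℝ, ContDiff ℝ ∞ γ ∧ HasCompactSupport γ ∧ ∀ u, 0 < u → deriv γ u = ψ u := by
  obtain ⟨b, hb⟩ := hc.isCompact.isBounded.subset_closedBall 0
  have hz : ∀ u, b < |u| → ψ u = 0 := fun u hu => by
    by_contra h
    have := hb (subset_tsupport _ (Function.mem_support.2 h))
    rw [mem_closedBall_zero_iff, Real.norm_eq_abs] at this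
    exact this.not_gt hu
  have hneg : ∀ u, 0 < u → ψ (-u) = 0 := fun u hu => by
    by_contra h
    have : 0 < -u := hs (subset_tsupport _ (Function.mem_support.2 h))
    linarith
  let η : ℝ → ℝ := fun u => ψ u - ψ (-u)
  have hη : ContDiff ℝ ∞ η := hψ.sub (hψ.comp contDiff_neg)
  have hηz : ∀ u, b < |u| → η u = 0 := fun u hu => by
    simp only [η]
    rw [hz u hu, hz (-u) (by rwa [abs_neg]), sub_zero]
  have hder : ∀ u, HasDerivAt (fun u => ∫ v in (-b)..u, η v) (η u) u :=
    fun u => (hη.continuous.integral_hasStrictDerivAt _ u).hasDerivAt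
  refine ⟨fun u => ∫ v in (-b)..u, η v, ?_, ?_, fun u hu => ?_⟩
  · rw [contDiff_infty_iff_deriv]
    exact ⟨fun u => (hder u).differentiableAt, by rwa [funext fun u => (hder u).deriv]⟩
  · have hii : ∀ a c, IntervalIntegrable η volume a c :=
      fun a c => hη.continuous.intervalIntegrable a c
    have hodd : ∫ v in (-b)..b, η v = 0 := by
      have h := intervalIntegral.integral_comp_neg (a := -b) (b := b) η
      have h2 : ∀ v, η (-v) = -η v := fun v => by simp [η]
      simp only [h2, intervalIntegral.integral_neg, neg_neg] at h
      linarith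
    refine HasCompactSupport.intro (isCompact_Icc (a := -|b|) (b := |b|)) fun u hu => ?_
    have hu' : |b| < |u| := by
      by_contra h
      exact hu (Set.mem_Icc.2 (abs_le.1 (not_lt.1 h)))
    rcases le_total 0 u with h0 | h0
    · rw [abs_of_nonneg h0] at hu'
      rw [← intervalIntegral.integral_add_adjacent_intervals (hii (-b) b) (hii b u), hodd,
        zero_add, intervalIntegral.integral_zero_ae]
      refine Eventually.of_forall fun v hv => hηz v ?_
      rw [Set.uIoc_of_le ((le_abs_self b).trans hu'.le)] at hv
      exact hv.1.trans_le (le_abs_self v)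
    · rw [abs_of_nonpos h0] at hu'
      rw [intervalIntegral.integral_symm, intervalIntegral.integral_zero_ae, neg_zero]
      have hae : ∀ᵐ v : ℝ, v ≠ -b := by simp [ae_iff]
      filter_upwards [hae] with v hvb hv
      refine hηz v ?_
      rw [Set.uIoc_of_le (by linarith [le_abs_self b])] at hv
      have := lt_of_le_of_ne hv.2 hvb
      linarith [neg_le_abs v]
  · rw [(hder u).deriv]
    simp only [η]
    rw [hneg u hu, sub_zero]

/-- If `F` and `G` are continuous and `F' = G` on `[0, ∞)` in the sense of distributions, boundary
term included, then `F` is a primitive of `G`. -/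
theorem eq_add_integral_of_forall_test {F G : ℝ → ℝ} (hF : Continuous F) (hG : Continuous G)
    (h : ∀ γ : ℝ → ℝ, ContDiff ℝ ∞ γ → HasCompactSupport γ →
      ∫ u in Set.Ioi (0 : ℝ), (deriv γ u * F u + γ u * G u) = -(γ 0 * F 0))
    {t : ℝ} (ht : 0 ≤ t) : F t = F 0 + ∫ u in (0 : ℝ)..t, G u := by
  let H : ℝ → ℝ := fun t => F 0 + ∫ u in (0 : ℝ)..t, G u
  have hH : ∀ u, HasDerivAt H (G u) u :=
    fun u => ((hG.integral_hasStrictDerivAt 0 u).hasDerivAt).const_add _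
  have hHc : Continuous H := continuous_iff_continuousAt.2 fun u => (hH u).continuousAt
  have hH0 : H 0 = F 0 := by simp [H]
  have hint : ∀ {γ K : ℝ → ℝ}, ContDiff ℝ ∞ γ → HasCompactSupport γ → Continuous K →
      Integrable (fun u => deriv γ u * K u + γ u * G u) := fun hγ hγc hK =>
    (((hγ.continuous_deriv (by simp)).mul hK).integrable_of_hasCompactSupport
      hγc.deriv.mul_right).add
      ((hγ.continuous.mul hG).integrable_of_hasCompactSupport hγc.mul_right)
  have key : ∀ γ : ℝ → ℝ, ContDiff ℝ ∞ γ → HasCompactSupport γ →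
      ∫ u in Set.Ioi (0 : ℝ), deriv γ u * (F u - H u) = 0 := by
    intro γ hγ hγc
    have h1 : ∫ u in Set.Ioi (0 : ℝ), (deriv γ u * H u + γ u * G u) = 0 - γ 0 * H 0 := by
      refine integral_Ioi_of_hasDerivAt_of_tendsto' (f := fun u => γ u * H u) (fun u _ => ?_)
        (hint hγ hγc hHc).integrableOn ?_
      · exact ((hγ.differentiable (by simp) u).hasDerivAt).mul (hH u)
      · have hc : HasCompactSupport fun u => γ u * H u := hγc.mul_right
        exact hc.is_zero_at_infty.mono_left atTop_le_cocompact
    have h2 := h γ hγ hγc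
    have h3 := integral_sub (hint hγ hγc hF).integrableOn (hint hγ hγc hHc).integrableOn
      (μ := volume.restrict (Set.Ioi 0))
    rw [h1, h2, hH0] at h3
    calc _ = _ := integral_congr_ae (Eventually.of_forall fun u => by ring)
      _ = _ := h3
      _ = 0 := by ring
  have hae : ∀ᵐ u : ℝ, u ∈ Set.Ioi (0 : ℝ) → F u - H u = 0 := by
    refine isOpen_Ioi.ae_eq_zero_of_integral_contDiff_smul_eq_zero
      ((hF.sub hHc).locallyIntegrable.locallyIntegrableOn _) fun ψ hψ hc hs => ?_
    obtain ⟨γ, hγ, hγc, hd⟩ := exists_contDiff_deriv_eq hψ hc hs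
    rw [← key γ hγ hγc, ← setIntegral_eq_integral_of_forall_compl_eq_zero (s := Set.Ioi 0)]
    · refine setIntegral_congr_fun measurableSet_Ioi fun u hu => ?_
      simp only [hd u hu, smul_eq_mul]
    · intro u hu
      rw [image_eq_zero_of_notMem_tsupport fun hu' => hu (hs hu'), zero_smul]
  have heq : Set.EqOn (fun u => F u - H u) (fun _ => 0) (Set.Ioi 0) :=
    Measure.eqOn_open_of_ae_eq ((ae_restrict_iff' measurableSet_Ioi).2 hae) isOpen_Ioi
      (hF.sub hHc).continuousOn continuousOn_const
  rcases ht.eq_or_lt with rfl | ht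
  · simp
  · exact sub_eq_zero.1 (heq ht)

end Weak

/-! ### Operators with the fundamental solution property -/

section FundamentalSolution

variable {d : ℕ}

/-- The product test function `(u, x) ↦ γ(u) f(x)`. -/
def SpaceTimeTest.prod {γ : ℝ → ℝ} (hγ : ContDiff ℝ ∞ γ) (hγc : HasCompactSupport γ)
    {f : C₀(EuclideanSpace ℝ (Fin d), ℝ)} (hf : f ∈ smoothCompact d) : SpaceTimeTest d where
  toFun q := γ q.1 * f q.2
  smooth := (hγ.comp contDiff_fst).mul (hf.1.comp contDiff_snd)
  compact_support := by
    refine HasCompactSupport.intro (hγc.isCompact.prod hf.2.isCompact) fun q hq => ?_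
    by_cases h : q.1 ∈ tsupport γ
    · rw [image_eq_zero_of_notMem_tsupport fun h' => hq ⟨h, h'⟩, mul_zero]
    · rw [image_eq_zero_of_notMem_tsupport h, zero_mul]

/-- On test functions, `A` satisfies the integrated Kolmogorov equation
`P_t f - f = ∫₀ᵗ P_u A f du`. -/
theorem levySemigroup_sub_eq_integral_of_mem_smoothCompact (p : ConvolutionSemigroup d)
    (A : C₀(EuclideanSpace ℝ (Fin d), ℝ) →ₗ.[ℝ] C₀(EuclideanSpace ℝ (Fin d), ℝ))
    (hle : smoothCompact d ≤ A.domain)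
    (hA : ∀ (s : ℝ) (x : EuclideanSpace ℝ (Fin d)) (φ : SpaceTimeTest d),
      ∫ u in Set.Ioi s, ∫ z,
          (deriv (fun v : ℝ => φ.toFun (v, x + z)) u +
            A ⟨φ.slice u, hle (φ.slice_mem u)⟩ (x + z))
          ∂(p.law (u - s).toNNReal : Measure (EuclideanSpace ℝ (Fin d))) =
        -φ.toFun (s, x))
    {f : C₀(EuclideanSpace ℝ (Fin d), ℝ)} (hf : f ∈ smoothCompact d) (t : ℝ≥0) :
    levySemigroup p t f - f =
      ∫ u in (0 : ℝ)..t, levySemigroup p u.toNNReal (A ⟨f, hle hf⟩) := by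
  set g := A ⟨f, hle hf⟩ with hg
  have hc : ∀ k : C₀(EuclideanSpace ℝ (Fin d), ℝ),
      Continuous fun u : ℝ => levySemigroup p u.toNNReal k := fun k =>
    (continuous_levySemigroup_toNNReal p).comp (continuous_const.prodMk continuous_id)
  ext x
  have hw : levySemigroup p t f x =
      f x + ∫ u in (0 : ℝ)..t, levySemigroup p u.toNNReal g x := by
    have h := eq_add_integral_of_forall_test (F := fun u => levySemigroup p u.toNNReal f x)
      (G := fun u => levySemigroup p u.toNNReal g x)
      ((evalC0 x).continuous.comp (hc f)) ((evalC0 x).continuous.comp (hc g)) ?_ t.coe_nonneg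
    · simpa [levySemigroup_zero] using h
    intro γ hγ hγc
    have h0 := hA 0 x (SpaceTimeTest.prod hγ hγc hf)
    simp only [Real.toNNReal_zero, levySemigroup_zero]
    refine Eq.trans ?_ h0
    refine setIntegral_congr_fun measurableSet_Ioi fun u _ => ?_
    have hslice : A ⟨(SpaceTimeTest.prod hγ hγc hf).slice u,
        hle ((SpaceTimeTest.prod hγ hγc hf).slice_mem u)⟩ = γ u • g := by
      rw [hg, ← LinearPMap.map_smul]
      rfl
    simp only [hslice, sub_zero]
    have hderiv : ∀ y, deriv (fun v : ℝ => (SpaceTimeTest.prod hγ hγc hf).toFun (v, y)) u =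
        deriv γ u * f y := fun y =>
      deriv_mul_const (hγ.differentiable (by simp) u) (f y)
    simp only [hderiv, ZeroAtInftyContinuousMap.smul_apply, smul_eq_mul, add_comm x]
    rw [integral_add ((integrable_translate _ f x).const_mul _)
      ((integrable_translate _ g x).const_mul _), integral_const_mul, integral_const_mul]
    rfl
  have he : (∫ u in (0 : ℝ)..t, levySemigroup p u.toNNReal g) x =
      ∫ u in (0 : ℝ)..t, levySemigroup p u.toNNReal g x :=
    ((evalC0 x).intervalIntegral_comp_comm ((hc g).intervalIntegrable 0 t)).symm
  rw [ZeroAtInftyContinuousMap.sub_apply, hw, he, add_sub_cancel_left]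

/-- If `A` is closed, the graph of `A` is the closure of the graph of its restriction to a core. -/
theorem LinearPMap.HasCore.graph_eq_topologicalClosure {Y : Type*} [NormedAddCommGroup Y]
    [NormedSpace ℝ Y] {A : Y →ₗ.[ℝ] Y} {S : Submodule ℝ Y} (h : A.HasCore S) (hA : A.IsClosed) :
    A.graph = (A.domRestrict S).graph.topologicalClosure := by
  have hcl : (A.domRestrict S).IsClosable := hA.isClosable.leIsClosable A.domRestrict_le
  rw [hcl.graph_closure_eq_closure_graph, h.closure_eq]

/-- A closed operator with core `C_c^∞` on which the integrated Kolmogorov equation holds is a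
restriction of the generator: the equation passes to limits in the graph norm. -/
theorem isGeneratorValue_of_mem_graph (p : ConvolutionSemigroup d)
    (A : C₀(EuclideanSpace ℝ (Fin d), ℝ) →ₗ.[ℝ] C₀(EuclideanSpace ℝ (Fin d), ℝ))
    (hclosed : A.IsClosed) (hcore : A.HasCore (smoothCompact d))
    (h : ∀ (f : C₀(EuclideanSpace ℝ (Fin d), ℝ)) (hf : f ∈ smoothCompact d) (t : ℝ≥0),
      levySemigroup p t f - f =
        ∫ u in (0 : ℝ)..t, levySemigroup p u.toNNReal (A ⟨f, hcore.le_domain hf⟩))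
    {q : C₀(EuclideanSpace ℝ (Fin d), ℝ) × C₀(EuclideanSpace ℝ (Fin d), ℝ)} (hq : q ∈ A.graph) :
    IsGeneratorValue (levySemigroup p) q.1 q.2 := by
  refine isGeneratorValue_of_forall_integral_eq p fun t => ?_
  have hJ := continuous_levySemigroup_toNNReal p
  have hset : IsClosed {q : C₀(EuclideanSpace ℝ (Fin d), ℝ) × C₀(EuclideanSpace ℝ (Fin d), ℝ) |
      levySemigroup p t q.1 - q.1 = ∫ u in (0 : ℝ)..t, levySemigroup p u.toNNReal q.2} := by
    refine isClosed_eq (Continuous.sub ?_ continuous_fst) ?_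
    · have := hJ.comp ((continuous_fst (X := C₀(EuclideanSpace ℝ (Fin d), ℝ))
        (Y := C₀(EuclideanSpace ℝ (Fin d), ℝ))).prodMk (continuous_const (y := (t : ℝ))))
      simpa [Function.comp_def] using this
    · exact intervalIntegral.continuous_parametric_intervalIntegral_of_continuous'
        (f := fun (q : C₀(EuclideanSpace ℝ (Fin d), ℝ) × C₀(EuclideanSpace ℝ (Fin d), ℝ))
          (u : ℝ) => levySemigroup p u.toNNReal q.2)
        (hJ.comp ((continuous_snd.comp continuous_fst).prodMk continuous_snd)) 0 t
  rw [hcore.graph_eq_topologicalClosure hclosed] at hq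
  refine closure_minimal (fun r hr => ?_) hset hq
  obtain ⟨y, hy1, hy2⟩ := (LinearPMap.mem_graph_iff _).1 hr
  have hy : (y : C₀(EuclideanSpace ℝ (Fin d), ℝ)) ∈ smoothCompact d := y.2.1
  rw [Set.mem_ofPred_eq, ← hy1, ← hy2, h _ hy t]
  rfl

/-- The bounded continuous function `x ↦ ℓ(f(x + ·))`, depending linearly and continuously on `f`;
for a signed measure `ℓ` this is, up to a reflection, the convolution of `f` and `ℓ`. -/
noncomputable def functionalConvolution (ℓ : C₀(EuclideanSpace ℝ (Fin d), ℝ) →L[ℝ] ℝ) :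
    C₀(EuclideanSpace ℝ (Fin d), ℝ) →L[ℝ]
      BoundedContinuousFunction (EuclideanSpace ℝ (Fin d)) ℝ :=
  LinearMap.mkContinuous
    { toFun := fun f => BoundedContinuousFunction.ofNormedAddCommGroup
        (fun x => ℓ (translateC0 x f)) (ℓ.continuous.comp (continuous_translateC0 f)) (‖ℓ‖ * ‖f‖)
        fun x => (ℓ.le_opNorm _).trans <|
          mul_le_mul_of_nonneg_left (norm_translateC0_le x f) (norm_nonneg _)
      map_add' := fun f g => by ext x; simp
      map_smul' := fun c f => by ext x; simp } ‖ℓ‖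
    fun f => BoundedContinuousFunction.norm_ofNormedAddCommGroup_le _ (by positivity)
      fun x => (ℓ.le_opNorm _).trans <|
        mul_le_mul_of_nonneg_left (norm_translateC0_le x f) (norm_nonneg _)

theorem functionalConvolution_apply (ℓ : C₀(EuclideanSpace ℝ (Fin d), ℝ) →L[ℝ] ℝ)
    (f : C₀(EuclideanSpace ℝ (Fin d), ℝ)) (x : EuclideanSpace ℝ (Fin d)) :
    functionalConvolution ℓ f x = ℓ (translateC0 x f) := rfl

theorem norm_functionalConvolution_levySemigroup_le (p : ConvolutionSemigroup d)
    (ℓ : C₀(EuclideanSpace ℝ (Fin d), ℝ) →L[ℝ] ℝ) (t : ℝ≥0)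
    (f : C₀(EuclideanSpace ℝ (Fin d), ℝ)) :
    ‖functionalConvolution ℓ (levySemigroup p t f)‖ ≤ ‖functionalConvolution ℓ f‖ := by
  refine norm_map_translationAverage_le _ (p.law t) fun z => ?_
  refine (BoundedContinuousFunction.norm_le (norm_nonneg _)).2 fun x => ?_
  rw [functionalConvolution_apply, translateC0_translateC0, ← functionalConvolution_apply]
  exact (functionalConvolution ℓ f).norm_coe_le_norm _

/-- If the generator `L` is defined on `C_c^∞`, then `1 - L` maps `C_c^∞` onto a dense subspace. If
`ℓ` annihilates the image, then `h(x) = ℓ(f(x + ·))` solves `h = Lh`, so `h = 0` by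
dissipativity. -/
theorem dense_range_sub_of_isGeneratorValue (p : ConvolutionSemigroup d)
    (B : smoothCompact d →ₗ[ℝ] C₀(EuclideanSpace ℝ (Fin d), ℝ))
    (hB : ∀ f : smoothCompact d, IsGeneratorValue (levySemigroup p) f (B f)) :
    Dense (LinearMap.range ((smoothCompact d).subtype - B) :
      Set C₀(EuclideanSpace ℝ (Fin d), ℝ)) := by
  set V := LinearMap.range ((smoothCompact d).subtype - B) with hV
  intro k
  by_contra hk
  obtain ⟨ℓ, c, hc, hℓ⟩ := geometric_hahn_banach_point_closed
    (V.topologicalClosure.convex) V.isClosed_topologicalClosure hk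
  have hc0 : c < 0 := by simpa using hℓ 0 (zero_mem _)
  -- A functional bounded below on a subspace vanishes on it.
  have hann : ∀ v ∈ V, ℓ v = 0 := by
    intro v hv
    by_contra hne
    have h := hℓ ((c / ℓ v) • v) (V.le_topologicalClosure (V.smul_mem _ hv))
    rw [map_smul, smul_eq_mul, div_mul_cancel₀ _ hne] at h
    exact h.false
  have hzero : ∀ f ∈ smoothCompact d, ℓ f = 0 := by
    intro f hf
    have hL := hB ⟨f, hf⟩
    have h0 : functionalConvolution ℓ (f - B ⟨f, hf⟩) = 0 := by
      ext x
      rw [functionalConvolution_apply, BoundedContinuousFunction.coe_zero, Pi.zero_apply]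
      have hfx := translateC0_mem_smoothCompact hf x
      refine hann _ ⟨⟨translateC0 x f, hfx⟩, ?_⟩
      have hBx : B ⟨translateC0 x f, hfx⟩ = translateC0 x (B ⟨f, hf⟩) :=
        (hB ⟨translateC0 x f, hfx⟩).unique (hL.translateC0 x)
      simp [hBx]
    have h1 := hL.norm_map_le (functionalConvolution ℓ)
      fun t => norm_functionalConvolution_levySemigroup_le p ℓ t f
    rw [h0, norm_zero] at h1
    have h2 := DFunLike.congr_fun (norm_le_zero_iff.1 h1) 0
    simpa [functionalConvolution_apply] using h2
  have hall : ℓ k = 0 :=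
    closure_minimal (t := {f | ℓ f = 0}) hzero (isClosed_eq ℓ.continuous continuous_const)
      (dense_smoothCompact d k)
  linarith

theorem mem_graph_infinitesimalGenerator_iff {Y : Type*} [NormedAddCommGroup Y] [NormedSpace ℝ Y]
    (P : ℝ≥0 → Y →ₗ[ℝ] Y) (q : Y × Y) :
    q ∈ (infinitesimalGenerator P).graph ↔ IsGeneratorValue P q.1 q.2 := by
  rw [LinearPMap.mem_graph_iff]
  constructor
  · rintro ⟨y, hy1, hy2⟩
    rw [← hy1, ← hy2]
    exact Classical.choose_spec y.2
  · intro h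
    exact ⟨⟨q.1, q.2, h⟩, rfl, (Classical.choose_spec (⟨q.2, h⟩ : ∃ g, _)).unique h⟩

theorem IsGeneratorValue.of_forall_mem_graph {Y : Type*} [NormedAddCommGroup Y]
    [NormedSpace ℝ Y] {P : ℝ≥0 → Y →ₗ[ℝ] Y} {A : Y →ₗ.[ℝ] Y}
    (hA : ∀ q ∈ A.graph, IsGeneratorValue P q.1 q.2) {S : Submodule ℝ Y} (hS : S ≤ A.domain)
    (f : S) : IsGeneratorValue P (f : Y) (A.toFun.comp (Submodule.inclusion hS) f) :=
  hA _ (A.mem_graph (Submodule.inclusion hS f))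

/-- A closed restriction `A` of the generator of a contraction family equals the generator as soon
as `1 - A` maps some subspace of its domain onto a dense subspace: by dissipativity, if
`(1 - A) g` is close to `(1 - L) f`, then `(g, A g)` is close to `(f, L f)`. -/
theorem eq_infinitesimalGenerator_of_dense_range {Y : Type*} [NormedAddCommGroup Y]
    [NormedSpace ℝ Y] {P : ℝ≥0 → Y →ₗ[ℝ] Y} (hP : ∀ t f, ‖P t f‖ ≤ ‖f‖) {A : Y →ₗ.[ℝ] Y}
    (hclosed : A.IsClosed) (hA : ∀ q ∈ A.graph, IsGeneratorValue P q.1 q.2)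
    {S : Submodule ℝ Y} (hS : S ≤ A.domain)
    (hdense : Dense (LinearMap.range (S.subtype - A.toFun.comp (Submodule.inclusion hS)) :
      Set Y)) :
    A = infinitesimalGenerator P := by
  refine LinearPMap.eq_of_eq_graph (le_antisymm (fun q hq =>
    (mem_graph_infinitesimalGenerator_iff _ q).2 (hA q hq)) fun q hq => ?_)
  have hq' := (mem_graph_infinitesimalGenerator_iff _ q).1 hq
  have hcl : IsClosed (A.graph : Set (Y × Y)) := hclosed
  refine hcl.closure_subset (Metric.mem_closure_iff.2 fun ε hε => ?_)
  obtain ⟨_, ⟨g, rfl⟩, hg⟩ := Metric.mem_closure_iff.1 (hdense (q.1 - q.2)) (ε / 2) (half_pos hε)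
  set k : Y := A.toFun.comp (Submodule.inclusion hS) g with hk
  have hgk : ((g : Y), k) ∈ A.graph := A.mem_graph (Submodule.inclusion hS g)
  refine ⟨_, hgk, ?_⟩
  have hsub : IsGeneratorValue P (q.1 - g) (q.2 - k) := by
    simpa [sub_eq_add_neg] using hq'.add ((hA _ hgk).smul (-1))
  have h1 := hsub.norm_map_le (ContinuousLinearMap.id ℝ _) fun t => hP t _
  simp only [ContinuousLinearMap.id_apply] at h1
  rw [LinearMap.sub_apply, Submodule.subtype_apply, ← hk, dist_eq_norm, sub_sub_sub_comm] at hg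
  rw [Prod.dist_eq, max_lt_iff, dist_eq_norm, dist_eq_norm]
  have h2 := norm_sub_le (q.1 - g) (q.1 - g - (q.2 - k))
  rw [sub_sub_cancel] at h2
  exact ⟨by linarith, by linarith⟩

end FundamentalSolution

theorem theorem4p6 (d : ℕ) (p : ConvolutionSemigroup d)
    (A : C₀(EuclideanSpace ℝ (Fin d), ℝ) →ₗ.[ℝ] C₀(EuclideanSpace ℝ (Fin d), ℝ))
    (hclosed : A.IsClosed)
    (hcore : A.HasCore (smoothCompact d))
    (hA : ∀ (s : ℝ) (x : EuclideanSpace ℝ (Fin d)) (φ : SpaceTimeTest d),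
      ∫ u in Set.Ioi s, ∫ z,
          (deriv (fun v : ℝ => φ.toFun (v, x + z)) u +
            A ⟨φ.slice u, hcore.le_domain (φ.slice_mem u)⟩ (x + z))
          ∂(p.law (u - s).toNNReal : Measure (EuclideanSpace ℝ (Fin d))) =
        -φ.toFun (s, x)) :
    A = levyGenerator p := by
  have hAL : ∀ q ∈ A.graph, IsGeneratorValue (levySemigroup p) q.1 q.2 := fun q hq =>
    isGeneratorValue_of_mem_graph p A hclosed hcore
      (fun f hf t => levySemigroup_sub_eq_integral_of_mem_smoothCompact p A hcore.le_domain hA hf t)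
      hq
  exact eq_infinitesimalGenerator_of_dense_range (norm_levySemigroup_le p) hclosed hAL
    hcore.le_domain (dense_range_sub_of_isGeneratorValue p _
      (IsGeneratorValue.of_forall_mem_graph hAL hcore.le_domain))
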